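/- Let $K$ be a field, let $S=K[x_1,\ldots,x_n]$ be the polynomial ring in $n$ variables, and let $d$ be a positive integer. Let $I\subset S$ be an ideal generated by square-free monomials all of degree $d$, and let $\mu(I)$ be the minimal number of generators of $I$. If $$\mu(I)>\frac{n-d}{n-d+1}\binom{n}{d},$$ then $\operatorname{depth}_S I=d$. Here a square-free monomial of degree $d$ is a product of $d$ distinct variables, and $\operatorname{depth}_S I$ is the maximal length of an $I$-regular sequence of elements of the ideal $(x_1,\ldots,x_n)$. (For $d>n$ the binomial coefficient, and with it the right-hand side of the inequality, is read as $0$; then $I=0$ and the hypothesis fails.) -/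

import Mathlib

/-- `f` is a square-free monomial of degree `d` in `K[x_1, …, x_n]`: the product of `d` distinct
variables. -/
def IsSquarefreeMonomialOfDegree {K : Type*} [CommSemiring K] {n : ℕ} (d : ℕ)
    (f : MvPolynomial (Fin n) K) : Prop :=
  ∃ F : Finset (Fin n), F.card = d ∧ f = ∏ i ∈ F, MvPolynomial.X i

open Classical in
/-- The grade of an ideal `J` on a module `M`: the supremum of the lengths of the `M`-regular
sequences of elements of `J`, with the usual convention that it is `∞` if `J M = M`. -/
noncomputable def idealGrade {R : Type*} [CommRing R] (J : Ideal R)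
    (M : Type*) [AddCommGroup M] [Module R M] : ℕ∞ :=
  if J • (⊤ : Submodule R M) = ⊤ then ⊤
  else ⨆ (rs : List R) (_ : (∀ r ∈ rs, r ∈ J) ∧ RingTheory.Sequence.IsRegular M rs),
    (rs.length : ℕ∞)

/-- The depth of a module `M` over `S = K[x_1, …, x_n]`: the grade of the graded maximal ideal
`(x_1, …, x_n)` on `M`. -/
noncomputable def polyDepth {K : Type*} [Field K] {n : ℕ}
    (M : Type*) [AddCommGroup M] [Module (MvPolynomial (Fin n) K) M] : ℕ∞ :=
  idealGrade (Ideal.span (Set.range (MvPolynomial.X : Fin n → MvPolynomial (Fin n) K))) M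

/-! Depth is read off from Koszul cohomology: a weakly regular sequence of length `t` in `(x)`
forces vanishing below degree `t` (`of_regular`), and over a Noetherian ring vanishing yields such a
sequence for finite modules (`quotient`, `exists_isWeaklyRegular`).

Depth at least `d`: adding multiples, `I` is spanned by an upper set of supports of size at least
`d`. Removing a smallest support `F` gives a subideal with quotient `S/(x_i : i ∉ F)`, whose Koszul
cohomology vanishes below `F.card`; induct.

Depth at most `d`: by double counting, the bound on `μ(I)` gives a `(d-1)`-set `G` all of whose
`d`-supersets are supports of generators. The differential of `x_G e_G` is then a cocycle over `I`,
but for degree reasons not a coboundary over `I` (`not_vanishesBelow`). -/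

namespace Koszul

open Finset

section Lift

variable {R ι M N : Type*} [CommRing R] [AddCommGroup M] [Module R M]
  [AddCommGroup N] [Module R N]

/-- Preserving zeros keeps the lifted cochain in the same degree. -/
lemma exists_lift {f : M →ₗ[R] N} (hf : Function.Surjective f) (c : Finset ι → N) :
    ∃ b : Finset ι → M, f ∘ b = c ∧ ∀ F, c F = 0 → b F = 0 := by
  classical
  choose g hg using hf
  refine ⟨fun F ↦ if c F = 0 then 0 else g (c F), ?_, fun F hF ↦ by simp [hF]⟩
  ext F
  by_cases h : c F = 0 <;> simp [h, hg]

lemma exists_preimage {f : M →ₗ[R] N} (hf : Function.Injective f) (c : Finset ι → N)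
    (hc : ∀ F, c F ∈ LinearMap.range f) :
    ∃ b : Finset ι → M, f ∘ b = c ∧ ∀ F, c F = 0 → b F = 0 := by
  choose b hb using hc
  exact ⟨b, funext hb, fun F hF ↦ hf (by rw [hb, hF, map_zero])⟩

end Lift

/-! ### Creation and annihilation operators -/

section Operators

variable {R ι M N : Type*} [CommRing R] [LinearOrder ι] [AddCommGroup M] [Module R M]
  [AddCommGroup N] [Module R N]

/-- The sign `(-1) ^ #{j ∈ F | j < i}` of inserting `i` into `F`. -/
def sign (R : Type*) [CommRing R] (i : ι) (F : Finset ι) : R :=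
  (-1) ^ #{j ∈ F | j < i}

lemma sign_mul_self (i : ι) (F : Finset ι) : sign R i F * sign R i F = 1 := by
  rw [sign, ← mul_pow]; simp

lemma sign_insert (i j : ι) (F : Finset ι) (hi : i ∉ F) :
    sign R j (insert i F) = if i < j then -sign R j F else sign R j F := by
  unfold sign
  rw [filter_insert]
  split_ifs with h
  · rw [card_insert_of_notMem (by simp [hi]), pow_succ]; ring
  · rfl

lemma sign_erase (i j : ι) (F : Finset ι) (hi : i ∈ F) :
    sign R j (F.erase i) = if i < j then -sign R j F else sign R j F := by
  have h := sign_insert (R := R) i j (F.erase i) (notMem_erase i F)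
  rw [insert_erase hi] at h
  split_ifs at h ⊢ <;> simp [h]

/-- Exterior multiplication by the basis vector `i` on functions `Finset ι → M`. -/
def create (R : Type*) [CommRing R] [Module R M] (i : ι) :
    (Finset ι → M) →ₗ[R] (Finset ι → M) where
  toFun c F := if i ∈ F then sign R i F • c (F.erase i) else 0
  map_add' c c' := by ext F; by_cases h : i ∈ F <;> simp [h]
  map_smul' r c := by ext F; by_cases h : i ∈ F <;> simp [h, smul_comm r]

/-- Contraction by the dual basis vector `i` on functions `Finset ι → M`. -/
def annihilate (R : Type*) [CommRing R] [Module R M] (i : ι) :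
    (Finset ι → M) →ₗ[R] (Finset ι → M) where
  toFun c F := if i ∈ F then 0 else sign R i F • c (insert i F)
  map_add' c c' := by ext F; by_cases h : i ∈ F <;> simp [h]
  map_smul' r c := by ext F; by_cases h : i ∈ F <;> simp [h, smul_comm r]

lemma create_apply (i : ι) (c : Finset ι → M) (F : Finset ι) :
    create R i c F = if i ∈ F then sign R i F • c (F.erase i) else 0 := rfl

lemma annihilate_apply (i : ι) (c : Finset ι → M) (F : Finset ι) :
    annihilate R i c F = if i ∈ F then 0 else sign R i F • c (insert i F) := rfl

lemma create_create_self (i : ι) (c : Finset ι → M) : create R i (create R i c) = 0 := by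
  ext F; simp [create_apply]

lemma create_create_add (i j : ι) (c : Finset ι → M) :
    create R i (create R j c) + create R j (create R i c) = 0 := by
  rcases eq_or_ne i j with rfl | hij
  · simp [create_create_self]
  ext F
  simp only [Pi.add_apply, create_apply, mem_erase, hij, hij.symm, ne_eq, not_false_eq_true,
    true_and, Pi.zero_apply]
  by_cases hi : i ∈ F <;> by_cases hj : j ∈ F <;> simp only [hi, hj, if_true, if_false, smul_zero,
    add_zero]
  rw [erase_right_comm, smul_smul, smul_smul, ← add_smul, sign_erase _ _ _ hi, sign_erase _ _ _ hj]
  rcases lt_or_gt_of_ne hij with h | h <;> simp [h, not_lt.2 h.le, mul_comm]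

lemma create_annihilate_add (i j : ι) (c : Finset ι → M) :
    create R i (annihilate R j c) + annihilate R j (create R i c) = if i = j then c else 0 := by
  rcases eq_or_ne i j with rfl | hij
  · ext F
    by_cases hi : i ∈ F
    · simp [create_apply, annihilate_apply, hi, smul_smul, sign_erase, sign_mul_self]
    · simp [create_apply, annihilate_apply, hi, smul_smul, sign_insert, sign_mul_self]
  · ext F
    simp only [Pi.add_apply, create_apply, annihilate_apply, mem_erase, mem_insert, hij, hij.symm,
      ne_eq, not_false_eq_true, true_and, false_or, if_false, Pi.zero_apply]
    by_cases hi : i ∈ F <;> by_cases hj : j ∈ F <;> simp only [hi, hj, if_true, if_false, smul_zero,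
      add_zero]
    rw [erase_insert_of_ne hij.symm, smul_smul, smul_smul, ← add_smul, sign_erase _ _ _ hi,
      sign_insert _ _ _ hj]
    rcases lt_or_gt_of_ne hij with h | h <;> simp [h, not_lt.2 h.le, mul_comm]

lemma create_map (i : ι) (f : M →ₗ[R] N) (c : Finset ι → M) :
    create R i (f ∘ c) = f ∘ create R i c := by
  ext F; by_cases h : i ∈ F <;> simp [create_apply, h]

end Operators

/-! ### The Koszul cochain complex -/

section Differential

variable {R ι M N : Type*} [CommRing R] [LinearOrder ι] [Fintype ι] [AddCommGroup M] [Module R M]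
  [AddCommGroup N] [Module R N] (x : ι → R)

/-- The differential of the Koszul cochain complex of the family `x` with coefficients in `M`,
with cochains regarded as functions `Finset ι → M`. -/
def diff : (Finset ι → M) →ₗ[R] (Finset ι → M) := ∑ i, x i • create R i

lemma diff_eq_sum (c : Finset ι → M) : diff x c = ∑ i, x i • create R i c := by
  simp [diff]

lemma diff_map (f : M →ₗ[R] N) (c : Finset ι → M) : diff x (f ∘ c) = f ∘ diff x c := by
  ext F; simp [diff_eq_sum, create_map]

lemma diff_apply (c : Finset ι → M) (F : Finset ι) :
    diff x c F = ∑ i ∈ F, (x i * sign R i F) • c (F.erase i) := by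
  simp only [diff_eq_sum, Finset.sum_apply, Pi.smul_apply, create_apply, smul_ite, smul_zero,
    smul_smul]
  simp

lemma diff_diff (c : Finset ι → M) : diff x (diff x c) = 0 := by
  suffices ∀ s : Finset ι, (∑ i ∈ s, x i • create R i) ((∑ i ∈ s, x i • create R i) c) = 0 from
    this univ
  intro s
  induction s using Finset.induction_on with
  | empty => simp
  | insert i s hi ih =>
    rw [sum_insert hi, LinearMap.add_apply, LinearMap.add_apply, map_add, map_add, ih, add_zero]
    simp only [LinearMap.smul_apply, map_smul, create_create_self, smul_zero, zero_add,
      LinearMap.sum_apply, map_sum, smul_sum, ← sum_add_distrib]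
    refine sum_eq_zero fun j _ ↦ ?_
    rw [smul_comm (x j) (x i), ← smul_add, ← smul_add, create_create_add, smul_zero, smul_zero]

/-- Cochains of degree `j`. -/
def IsHomogeneous (j : ℕ) (c : Finset ι → M) : Prop := ∀ F, F.card ≠ j → c F = 0

/-- Cochains of degree `j - 1`, which vanish if `j = 0`. -/
def IsHomogeneousPred (j : ℕ) (c : Finset ι → M) : Prop := ∀ F, F.card + 1 ≠ j → c F = 0

lemma diff_homogeneous {j : ℕ} {c : Finset ι → M} (hc : IsHomogeneousPred j c) :
    IsHomogeneous j (diff x c) := by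
  intro F hF
  rw [diff_apply]
  refine sum_eq_zero fun i hi ↦ ?_
  rw [hc, smul_zero]
  rwa [card_erase_add_one hi]

/-- By the anticommutation relations only the `i`-th term of the differential survives, so
contraction is a null-homotopy for `x i`. -/
lemma diff_annihilate_add (i : ι) (c : Finset ι → M) :
    diff x (annihilate R i c) + annihilate R i (diff x c) = x i • c := by
  simp only [diff_eq_sum, map_sum, map_smul, ← sum_add_distrib, ← smul_add,
    create_annihilate_add]
  simp

/-- Every element of the ideal generated by `x` acts on the Koszul complex as zero up to
homotopy. -/
lemma exists_homotopy {r : R} (hr : r ∈ Ideal.span (Set.range x)) :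
    ∃ h : (Finset ι → M) →ₗ[R] (Finset ι → M),
      (∀ c, diff x (h c) + h (diff x c) = r • c) ∧
      ∀ j c, IsHomogeneous j c → IsHomogeneousPred j (h c) := by
  induction hr using Submodule.span_induction with
  | mem r hr =>
    obtain ⟨i, rfl⟩ := hr
    refine ⟨annihilate R i, diff_annihilate_add x i, fun j c hc F hF ↦ ?_⟩
    rw [annihilate_apply]
    split_ifs with h
    · rfl
    · rw [hc _ (by rwa [card_insert_of_notMem h]), smul_zero]
  | zero => exact ⟨0, by simp, fun _ _ _ _ _ ↦ rfl⟩
  | add r s _ _ hr hs =>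
    obtain ⟨h, h₁, h₂⟩ := hr
    obtain ⟨k, k₁, k₂⟩ := hs
    refine ⟨h + k, fun c ↦ ?_, fun j c hc F hF ↦ ?_⟩
    · rw [add_smul, ← h₁, ← k₁]; simp only [LinearMap.add_apply, map_add]; abel
    · simp [h₂ j c hc F hF, k₂ j c hc F hF]
  | smul a r _ hr =>
    obtain ⟨h, h₁, h₂⟩ := hr
    refine ⟨a • h, fun c ↦ ?_, fun j c hc F hF ↦ ?_⟩
    · rw [smul_assoc, ← h₁]; simp
    · simp [h₂ j c hc F hF]

/-- The Koszul cohomology of `x` with coefficients in `M` vanishes in degrees less than `t`. -/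
def VanishesBelow (M : Type*) [AddCommGroup M] [Module R M] (t : ℕ) : Prop :=
  ∀ j < t, ∀ c : Finset ι → M, IsHomogeneous j c → diff x c = 0 →
    ∃ b, IsHomogeneousPred j b ∧ diff x b = c

variable {x}

lemma VanishesBelow.mono {s t : ℕ} (h : VanishesBelow x M t) (hst : s ≤ t) :
    VanishesBelow x M s := fun j hj ↦ h j (hj.trans_le hst)

lemma vanishesBelow_zero : VanishesBelow x M 0 := fun _ hj ↦ absurd hj (Nat.not_lt_zero _)

/-- The middle of the long exact cohomology sequence, chased by hand. -/
lemma VanishesBelow.of_exact {A B C : Type*} [AddCommGroup A] [Module R A] [AddCommGroup B]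
    [Module R B] [AddCommGroup C] [Module R C] {f : A →ₗ[R] B} {g : B →ₗ[R] C}
    (hf : Function.Injective f) (hfg : Function.Exact f g) (hg : Function.Surjective g) {t : ℕ}
    (hA : VanishesBelow x A t) (hC : VanishesBelow x C t) : VanishesBelow x B t := by
  intro j hj c hc hdc
  obtain ⟨b', hb', hdb'⟩ := hC j hj (g ∘ c) (fun F hF ↦ by simp [hc F hF])
    (by rw [diff_map, hdc]; ext; simp)
  obtain ⟨b, rfl, hb⟩ := exists_lift hg b'
  obtain ⟨a, ha, ha'⟩ := exists_preimage hf (c - diff x b) fun F ↦ by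
    rw [LinearMap.mem_range, ← Set.mem_range, ← hfg]
    rw [diff_map] at hdb'
    simpa [sub_eq_zero] using (congrFun hdb' F).symm
  have hdb := diff_homogeneous x (j := j) (c := b) fun F hF ↦ hb F (hb' F hF)
  obtain ⟨e, he, rfl⟩ := hA j hj a (fun F hF ↦ ha' F (by simp [hc F hF, hdb F hF])) <| by
    apply hf.comp_left
    change f ∘ diff x a = f ∘ (0 : Finset ι → A)
    rw [← diff_map, ha, map_sub, hdc, diff_diff]
    ext; simp
  refine ⟨b + f ∘ e, fun F hF ↦ by simp [hb F (hb' F hF), he F hF], ?_⟩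
  rw [map_add, diff_map, ha]
  abel

lemma VanishesBelow.congr (e : M ≃ₗ[R] N) {t : ℕ} (h : VanishesBelow x M t) :
    VanishesBelow x N t := by
  refine VanishesBelow.of_exact (f := e.toLinearMap) (g := (0 : N →ₗ[R] PUnit)) e.injective
    (fun n ↦ ?_) (fun _ ↦ ⟨0, rfl⟩) h fun j _ c _ _ ↦ ⟨0, fun _ _ ↦ rfl, Subsingleton.elim _ _⟩
  simp

section Regular

variable {r : R} {π : M →ₗ[R] N}

/-- For a cocycle `c`, the homotopy `k` gives `r • c = d (k c)`. Hence `k c` is a cocycle modulo `r`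
of one degree lower, so `k c = d v + r • w`; applying `d` and cancelling `r` leaves `c = d w`. -/
lemma VanishesBelow.of_regular (hr : r ∈ Ideal.span (Set.range x)) (hreg : IsSMulRegular M r)
    (hπ : Function.Surjective π) (hker : ∀ m, π m = 0 ↔ ∃ m', m = r • m') {t : ℕ}
    (h : VanishesBelow x N t) : VanishesBelow x M (t + 1) := by
  intro j hj c hc hdc
  obtain ⟨k, hk, hk'⟩ := exists_homotopy (M := M) x hr
  have hrc : diff x (k c) = r • c := by simpa [hdc] using hk c
  have hkc := hk' j c hc
  obtain ⟨v, hv⟩ : ∃ v : Finset ι → M, π ∘ diff x v = π ∘ k c ∧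
      ∀ F, F.card + 1 ≠ j → diff x v F = 0 := by
    rcases j with _ | j
    · exact ⟨0, by ext F; simp [hkc F (by simp)], by simp⟩
    · obtain ⟨v', hv', hdv'⟩ := h j (by omega) (π ∘ k c)
        (fun F hF ↦ by simp [hkc F (by simpa using hF)])
        (by rw [diff_map, hrc]; ext F; exact (hker _).2 ⟨c F, rfl⟩)
      obtain ⟨v, rfl, hv⟩ := exists_lift hπ v'
      refine ⟨v, by rw [← diff_map, hdv'], fun F hF ↦ ?_⟩
      exact diff_homogeneous x (fun F hF ↦ hv F (hv' F hF)) F (by simpa using hF)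
  have hw : ∀ F, ∃ w, k c F - diff x v F = r • w := fun F ↦ by
    rw [← hker, map_sub, sub_eq_zero]
    exact (congrFun hv.1 F).symm
  choose w hw using hw
  have hw' : r • w = k c - diff x v := funext fun F ↦ (hw F).symm
  refine ⟨w, fun F hF ↦ hreg ?_, ?_⟩
  · simp only [smul_zero]
    rw [← hw, hkc F hF, hv.2 F hF, sub_zero]
  · have : r • diff x w = r • c := by
      rw [← map_smul, hw', map_sub, diff_diff, hrc, sub_zero]
    exact funext fun F ↦ hreg (congrFun this F)

/-- Lift the cocycle to `c`, so `d c = r • w`. Regularity makes `w` a cocycle, so `w = d v`; then `c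
- r • v` is a cocycle lifting the same class, hence a coboundary. -/
lemma VanishesBelow.quotient (hreg : IsSMulRegular M r)
    (hπ : Function.Surjective π) (hker : ∀ m, π m = 0 ↔ ∃ m', m = r • m') {t : ℕ}
    (h : VanishesBelow x M (t + 1)) : VanishesBelow x N t := by
  intro j hj c' hc' hdc'
  obtain ⟨c, rfl, hc⟩ := exists_lift hπ c'
  have hch : IsHomogeneous j c := fun F hF ↦ hc F (hc' F hF)
  have hw : ∀ F, ∃ w, diff x c F = r • w := fun F ↦ by
    rw [diff_map] at hdc'
    exact (hker _).1 (congrFun hdc' F)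
  choose w hw using hw
  have hw' : diff x c = r • w := funext hw
  obtain ⟨v, hv, hdv⟩ := h (j + 1) (by omega) w
    (fun F hF ↦ hreg (by
      simp only [smul_zero]
      rw [← hw]
      exact diff_homogeneous x (j := j + 1) (fun F hF ↦ hch F (by simpa using hF)) F hF))
    (funext fun F ↦ hreg (by
      have := diff_diff x c
      rw [hw', map_smul] at this
      simpa using congrFun this F))
  obtain ⟨u, hu, hdu⟩ := h j (by omega) (c - r • v)
    (fun F hF ↦ by simp [hch F hF, hv F (by simpa using hF)])
    (by rw [map_sub, map_smul, hdv, hw', sub_self])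
  refine ⟨π ∘ u, fun F hF ↦ by simp [hu F hF], ?_⟩
  rw [diff_map, hdu]
  ext F
  simpa using (hker (r • v F)).2 ⟨_, rfl⟩

end Regular

open Pointwise in
lemma quotSMulTop_mkQ_eq_zero_iff (r : R) (m : M) :
    (r • (⊤ : Submodule R M)).mkQ m = 0 ↔ ∃ m', m = r • m' := by
  rw [Submodule.mkQ_apply, Submodule.Quotient.mk_eq_zero, Submodule.mem_smul_pointwise_iff_exists]
  simp [eq_comm]

end Differential

/-! ### Koszul vanishing and regular sequences -/

section Depth

open RingTheory.Sequence

variable {R ι : Type*} [CommRing R] [LinearOrder ι] [Fintype ι] {x : ι → R}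

lemma VanishesBelow.of_isWeaklyRegular (rs : List R) (hrs : ∀ r ∈ rs, r ∈ Ideal.span (Set.range x))
    (M : Type*) [AddCommGroup M] [Module R M] (h : IsWeaklyRegular M rs) :
    VanishesBelow x M rs.length := by
  induction rs generalizing M with
  | nil => exact vanishesBelow_zero
  | cons r rs ih =>
    rw [isWeaklyRegular_cons_iff] at h
    exact (ih (fun s hs ↦ hrs s (List.mem_cons_of_mem _ hs)) _ h.2).of_regular
      (hrs r List.mem_cons_self) h.1 (Submodule.mkQ_surjective _) (quotSMulTop_mkQ_eq_zero_iff r)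

lemma VanishesBelow.eq_zero {M : Type*} [AddCommGroup M] [Module R M] {t : ℕ}
    (h : VanishesBelow x M (t + 1)) {m : M} (hm : ∀ i, x i • m = 0) : m = 0 := by
  obtain ⟨b, hb, hdb⟩ := h 0 (by omega) (Pi.single ∅ m)
    (fun F hF ↦ by simp [card_ne_zero.1 hF |>.ne_empty]) (by
      ext F
      rw [diff_apply]
      refine sum_eq_zero fun i _ ↦ ?_
      by_cases hF : F.erase i = ∅
      · rw [hF, mul_comm, mul_smul]; simp [hm]
      · simp [hF])
  have : b = 0 := funext fun F ↦ hb F (by simp)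
  subst this
  simpa using (congrFun hdb ∅).symm

lemma VanishesBelow.exists_isWeaklyRegular [IsNoetherianRing R] {t : ℕ} (M : Type*)
    [AddCommGroup M] [Module R M] [Module.Finite R M] (h : VanishesBelow x M t) :
    ∃ rs : List R, (∀ r ∈ rs, r ∈ Ideal.span (Set.range x)) ∧ IsWeaklyRegular M rs ∧
      rs.length = t := by
  induction t generalizing M with
  | zero => exact ⟨[], by simp, .nil R M, rfl⟩
  | succ t ih =>
    -- Vanishing in degree 0 means that no nonzero element is killed by `(x)`; for a finite module
    -- over a Noetherian ring, `(x)` then contains a regular element.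
    have : Subsingleton ((R ⧸ Ideal.span (Set.range x)) →ₗ[R] M) := by
      refine subsingleton_of_forall_eq 0 fun f ↦ ?_
      have hx (i : ι) : Ideal.Quotient.mk (Ideal.span (Set.range x)) (x i) = 0 :=
        Ideal.Quotient.eq_zero_iff_mem.2 (Ideal.subset_span ⟨i, rfl⟩)
      have hf : f 1 = 0 := h.eq_zero fun i ↦ by
        rw [← map_smul, Algebra.smul_def, mul_one, Ideal.Quotient.algebraMap_eq, hx, map_zero]
      ext
      simpa using hf
    obtain ⟨r, hr, hreg⟩ := IsSMulRegular.subsingleton_linearMap_iff.1 this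
    rw [Ideal.annihilator_quotient] at hr
    obtain ⟨rs, h₁, h₂, h₃⟩ := ih (QuotSMulTop r M)
      (h.quotient hreg (Submodule.mkQ_surjective _) (quotSMulTop_mkQ_eq_zero_iff r))
    refine ⟨r :: rs, by simpa [hr] using h₁, h₂.cons hreg, by simp [h₃]⟩

end Depth

end Koszul

/-! ### Square-free monomial ideals -/

namespace SquarefreeMonomialIdeal

open MvPolynomial Koszul

variable {K ι : Type*} [Field K]

/-- The exponent vector of the square-free monomial with support `F`. -/
noncomputable def exponent (F : Finset ι) : ι →₀ ℕ := ∑ i ∈ F, Finsupp.single i 1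

lemma exponent_apply [DecidableEq ι] (F : Finset ι) (i : ι) :
    exponent F i = if i ∈ F then 1 else 0 := by
  simp [exponent, Finsupp.finsetSum_apply, Finsupp.single_apply]

lemma degree_exponent (F : Finset ι) : (exponent F).degree = F.card := by
  simp [exponent, map_sum]

lemma prod_X_eq_monomial (F : Finset ι) :
    ∏ i ∈ F, (X i : MvPolynomial ι K) = monomial (exponent F) 1 := by
  rw [exponent, monomial_sum_one]; rfl

lemma prod_X_mem_pow_iff (F : Finset ι) (d : ℕ) :
    ∏ i ∈ F, (X i : MvPolynomial ι K) ∈ idealOfVars ι K ^ d ↔ d ≤ F.card := by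
  rw [prod_X_eq_monomial, monomial_mem_pow_idealOfVars_iff _ _ one_ne_zero, degree_exponent]

lemma exponent_le_iff (F G : Finset ι) : exponent F ≤ exponent G ↔ F ⊆ G := by
  classical
  simp only [Finsupp.le_def, exponent_apply]
  refine ⟨fun h i hi ↦ ?_, fun h i ↦ ?_⟩
  · by_contra hG
    simpa [hi, hG] using h i
  · by_cases hi : i ∈ F
    · simp [hi, h hi]
    · simp [hi]

lemma prod_X_injective :
    Function.Injective fun F : Finset ι ↦ ∏ i ∈ F, (X i : MvPolynomial ι K) := by
  intro F G h
  have h' : exponent F = exponent G := by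
    simpa [prod_X_eq_monomial, monomial_left_inj] using h
  exact subset_antisymm ((exponent_le_iff _ _).1 h'.le) ((exponent_le_iff _ _).1 h'.ge)

/-- The ideal generated by the square-free monomials with supports in `U`. -/
noncomputable def squarefreeIdeal (K : Type*) [Field K] (U : Finset (Finset ι)) :
    Ideal (MvPolynomial ι K) :=
  Ideal.span ((fun F ↦ ∏ i ∈ F, X i) '' (U : Set (Finset ι)))

lemma mem_squarefreeIdeal {U : Finset (Finset ι)} {f : MvPolynomial ι K} :
    f ∈ squarefreeIdeal K U ↔ ∀ m ∈ f.support, ∃ F ∈ U, exponent F ≤ m := by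
  have := mem_ideal_span_monomial_image (x := f) (s := exponent '' (U : Set (Finset ι)))
  rw [Set.image_image] at this
  simp only [squarefreeIdeal, prod_X_eq_monomial]
  simpa using this

lemma prod_X_mem_squarefreeIdeal {U : Finset (Finset ι)} {F : Finset ι} (hF : F ∈ U) :
    ∏ i ∈ F, X i ∈ squarefreeIdeal K U :=
  Ideal.subset_span ⟨F, hF, rfl⟩

lemma mem_support_mul_prod_X {f : MvPolynomial ι K} {m : ι →₀ ℕ} (F : Finset ι)
    (hm : m ∈ f.support) : m + exponent F ∈ (f * ∏ i ∈ F, X i).support := by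
  rw [prod_X_eq_monomial, mem_support_iff, coeff_mul_monomial, mul_one]
  exact mem_support_iff.1 hm

lemma isSMulRegular_X (T : Finset ι) (j : ι) (hj : j ∉ T) :
    IsSMulRegular (MvPolynomial ι K ⧸ (Ideal.span (X '' (T : Set ι)) : Ideal (MvPolynomial ι K)))
      (X j : MvPolynomial ι K) := by
  rw [isSMulRegular_iff_right_eq_zero_of_smul]
  intro q hq
  obtain ⟨f, rfl⟩ := Ideal.Quotient.mk_surjective q
  change Ideal.Quotient.mk _ (X j * f) = 0 at hq
  rw [Ideal.Quotient.eq_zero_iff_mem, mem_ideal_span_X_image] at hq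
  rw [Ideal.Quotient.eq_zero_iff_mem, mem_ideal_span_X_image]
  intro m hm
  obtain ⟨i, hi, hmi⟩ := hq (Finsupp.single j 1 + m) (by
    rw [mem_support_iff, coeff_X_mul]; exact mem_support_iff.1 hm)
  refine ⟨i, hi, ?_⟩
  rwa [Finsupp.add_apply, Finsupp.single_eq_of_ne (by rintro rfl; exact hj hi), zero_add] at hmi

section Quotients

variable [LinearOrder ι] [Fintype ι]

/-- The `k` variables outside `T` form a regular sequence on the quotient; each is killed in turn.
-/
lemma vanishesBelow_quotient_span_X (k : ℕ) (T : Finset ι) (hT : T.card + k = Fintype.card ι) :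
    VanishesBelow (X : ι → MvPolynomial ι K)
      (MvPolynomial ι K ⧸ (Ideal.span (X '' (T : Set ι)) : Ideal (MvPolynomial ι K))) k := by
  induction k generalizing T with
  | zero => exact vanishesBelow_zero
  | succ k ih =>
    obtain ⟨j, hj⟩ : ∃ j, j ∉ T := by
      by_contra! h
      have := Finset.card_eq_iff_eq_univ T |>.2 (Finset.eq_univ_iff_forall.2 h)
      omega
    have hle : (Ideal.span (X '' (T : Set ι)) : Ideal (MvPolynomial ι K)) ≤
        Ideal.span (X '' ((insert j T : Finset ι) : Set ι)) :=
      Ideal.span_mono (Set.image_mono (by simp))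
    refine VanishesBelow.of_regular (r := X j) (π := Submodule.factor hle)
      (Ideal.subset_span ⟨j, rfl⟩) (isSMulRegular_X T j hj) (Submodule.factor_surjective hle)
      (fun q ↦ ?_) (ih _ (by rw [Finset.card_insert_of_notMem hj]; omega))
    obtain ⟨f, rfl⟩ := Submodule.Quotient.mk_surjective _ q
    change Submodule.Quotient.mk f = 0 ↔ _
    rw [Submodule.Quotient.mk_eq_zero, Finset.coe_insert, Set.image_insert_eq,
      Ideal.mem_span_insert]
    constructor
    · rintro ⟨a, z, hz, rfl⟩
      refine ⟨Submodule.Quotient.mk a, ?_⟩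
      rw [← Submodule.Quotient.mk_smul, Submodule.Quotient.eq]
      simpa [mul_comm] using hz
    · rintro ⟨q, hq⟩
      obtain ⟨a, rfl⟩ := Submodule.Quotient.mk_surjective _ q
      rw [← Submodule.Quotient.mk_smul, Submodule.Quotient.eq] at hq
      exact ⟨a, _, hq, by simp [mul_comm]⟩

/-- Any other `G` in `U` is at least as large as `F`, so it has a variable outside `F`; conversely
`insert i F` stays in the upper set. -/
lemma mul_prod_X_mem_iff {U : Finset (Finset ι)} (hU : IsUpperSet (U : Set (Finset ι)))
    {F : Finset ι} (hF : F ∈ U) (hmin : ∀ G ∈ U, F.card ≤ G.card) (f : MvPolynomial ι K) :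
    f * ∏ i ∈ F, X i ∈ squarefreeIdeal K (U.erase F) ↔
      f ∈ Ideal.span (X '' ((Fᶜ : Finset ι) : Set ι)) := by
  constructor
  · rw [mem_squarefreeIdeal, mem_ideal_span_X_image]
    intro h m hm
    obtain ⟨G, hG, hGm⟩ := h _ (mem_support_mul_prod_X F hm)
    rw [Finset.mem_erase] at hG
    obtain ⟨i, hiG, hiF⟩ : ∃ i ∈ G, i ∉ F := by
      by_contra! h'
      exact hG.1 (Finset.eq_of_subset_of_card_le h' (hmin G hG.2))
    refine ⟨i, by simpa using hiF, ?_⟩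
    have := hGm i
    simp [exponent_apply, hiG, hiF] at this
    omega
  · intro h
    suffices Ideal.span (X '' ((Fᶜ : Finset ι) : Set ι)) ≤
        Submodule.comap (LinearMap.mulRight (MvPolynomial ι K)
          (∏ i ∈ F, (X i : MvPolynomial ι K))) (squarefreeIdeal K (U.erase F)) from this h
    rw [Ideal.span_le]
    rintro _ ⟨i, hi, rfl⟩
    have hi' : i ∉ F := by simpa using hi
    change X i * ∏ i ∈ F, X i ∈ squarefreeIdeal K (U.erase F)
    rw [← Finset.prod_insert hi']
    refine prod_X_mem_squarefreeIdeal (Finset.mem_erase.2 ⟨?_, hU (Finset.subset_insert i F) hF⟩)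
    exact fun h ↦ hi' (h ▸ Finset.mem_insert_self i F)

lemma vanishesBelow_squarefreeIdeal {d : ℕ} (U : Finset (Finset ι))
    (hU : IsUpperSet (U : Set (Finset ι))) (hd : ∀ F ∈ U, d ≤ F.card) :
    VanishesBelow (X : ι → MvPolynomial ι K) (squarefreeIdeal K U) d := by
  induction U using Finset.strongInduction with
  | H U ih =>
    rcases U.eq_empty_or_nonempty with rfl | hne
    · have : squarefreeIdeal K (∅ : Finset (Finset ι)) = ⊥ := by simp [squarefreeIdeal]
      rw [this]
      exact fun j _ c _ _ ↦ ⟨0, fun _ _ ↦ rfl, Subsingleton.elim _ _⟩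
    obtain ⟨F, hF, hmin⟩ := U.exists_min_image Finset.card hne
    have hlower : IsUpperSet ((U.erase F : Finset (Finset ι)) : Set (Finset ι)) := by
      intro A B hAB hA
      simp only [Finset.coe_erase, Set.mem_sdiff, Finset.mem_coe, Set.mem_singleton_iff] at hA ⊢
      refine ⟨hU hAB hA.1, ?_⟩
      rintro rfl
      exact hA.2 (Finset.eq_of_subset_of_card_le hAB (hmin A hA.1))
    have hA := ih (U.erase F) (Finset.erase_ssubset hF) hlower
      fun G hG ↦ hd G (Finset.mem_of_mem_erase hG)
    have hle : squarefreeIdeal K (U.erase F) ≤ squarefreeIdeal K U :=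
      Ideal.span_mono (Set.image_mono (by simp))
    have hins : squarefreeIdeal K U = Ideal.span (insert (∏ i ∈ F, X i)
        ((fun F ↦ ∏ i ∈ F, X i) '' ((U.erase F : Finset (Finset ι)) : Set (Finset ι)))) := by
      rw [← Set.image_insert_eq (f := fun F : Finset ι ↦ ∏ i ∈ F, (X i : MvPolynomial ι K)),
        ← Finset.coe_insert, Finset.insert_erase hF, squarefreeIdeal]
    let A := LinearMap.range (Submodule.inclusion hle)
    -- Multiplication by `x_F` modulo the smaller ideal; its kernel is the colon ideal `(x_i : i ∉
    -- F)`.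
    let φ : MvPolynomial ι K →ₗ[MvPolynomial ι K] (squarefreeIdeal K U ⧸ A) :=
      A.mkQ ∘ₗ LinearMap.toSpanSingleton (MvPolynomial ι K) (squarefreeIdeal K U)
        ⟨_, prod_X_mem_squarefreeIdeal hF⟩
    have memA (b : squarefreeIdeal K U) : b ∈ A ↔ (b : MvPolynomial ι K) ∈
        squarefreeIdeal K (U.erase F) := by
      simp [A, Submodule.range_inclusion]
    have hker : LinearMap.ker φ = Ideal.span (X '' ((Fᶜ : Finset ι) : Set ι)) := by
      ext f
      rw [LinearMap.mem_ker, ← mul_prod_X_mem_iff hU hF hmin f]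
      change A.mkQ _ = 0 ↔ _
      rw [Submodule.mkQ_apply, Submodule.Quotient.mk_eq_zero, memA]
      rfl
    have hsurj : Function.Surjective φ := by
      intro q
      obtain ⟨⟨b, hb⟩, rfl⟩ := Submodule.Quotient.mk_surjective _ q
      have hb' := hb
      rw [hins, Ideal.mem_span_insert] at hb'
      obtain ⟨a, z, hz, rfl⟩ := hb'
      refine ⟨a, ?_⟩
      change Submodule.Quotient.mk _ = Submodule.Quotient.mk _
      rw [Submodule.Quotient.eq, memA]
      change a * ∏ i ∈ F, X i - (a * ∏ i ∈ F, X i + z) ∈ squarefreeIdeal K (U.erase F)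
      rw [sub_add_cancel_left]
      exact neg_mem hz
    have hC : VanishesBelow (X : ι → MvPolynomial ι K) (squarefreeIdeal K U ⧸ A) d :=
      ((vanishesBelow_quotient_span_X F.card Fᶜ (Finset.card_compl_add_card F)).mono
        (hd F hF)).congr
        ((Submodule.quotEquivOfEq _ _ hker.symm).trans (φ.quotKerEquivOfSurjective hsurj))
    exact VanishesBelow.of_exact (f := Submodule.inclusion hle) (g := A.mkQ)
      (Submodule.inclusion_injective hle)
      (LinearMap.exact_iff.2 (Submodule.ker_mkQ A)) (Submodule.mkQ_surjective A) hA hC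

lemma not_vanishesBelow {d : ℕ} {I : Ideal (MvPolynomial ι K)} (hI : I ≤ idealOfVars ι K ^ d)
    {G : Finset ι} (hG : G.card + 1 = d) (hGI : ∀ i ∉ G, ∏ j ∈ insert i G, X j ∈ I)
    {i : ι} (hi : i ∉ G) : ¬ VanishesBelow (X : ι → MvPolynomial ι K) I (d + 1) := by
  intro h
  -- The cochain `x_G e_G` takes values in `S`; only its differential need lie in `I`.
  set y : Finset ι → MvPolynomial ι K := Pi.single G (∏ j ∈ G, X j)
  have hyh : IsHomogeneousPred d y := by
    intro F hF
    have : F ≠ G := by rintro rfl; exact hF hG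
    simp [y, this]
  obtain ⟨c, hc, hc'⟩ := exists_preimage (f := I.subtype) I.injective_subtype
      (diff (X : ι → MvPolynomial ι K) y) <| by
    intro F
    rw [Submodule.range_subtype, diff_apply]
    refine Ideal.sum_mem _ fun j hj ↦ ?_
    by_cases hF : F.erase j = G
    · have hjG : j ∉ G := hF ▸ Finset.notMem_erase j F
      have := hGI j hjG
      rw [Finset.prod_insert hjG] at this
      rw [hF, smul_eq_mul, mul_right_comm]
      simpa [y] using I.mul_mem_right _ this
    · simp [y, hF]
  obtain ⟨b, -, hb⟩ := h d (by omega) c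
    (fun F hF ↦ hc' F (diff_homogeneous (X : ι → MvPolynomial ι K) hyh F hF)) <| by
    apply I.injective_subtype.comp_left
    change I.subtype ∘ diff (X : ι → MvPolynomial ι K) c = I.subtype ∘ (0 : Finset ι → I)
    rw [← diff_map, hc, diff_diff]
    ext F : 1
    simp
  -- A coboundary over `I` gains one degree, while this coefficient is `±x_{G ∪ {i}}`, of degree
  -- only `d`.
  have hmem : diff (X : ι → MvPolynomial ι K) y (insert i G) ∈ idealOfVars ι K ^ (d + 1) := by
    rw [← hc, ← hb, ← diff_map, diff_apply]
    refine Ideal.sum_mem _ fun j _ ↦ ?_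
    rw [smul_eq_mul, pow_succ', mul_assoc]
    exact Ideal.mul_mem_mul (Ideal.subset_span ⟨j, rfl⟩) (Ideal.mul_mem_left _ _ (hI (b _).2))
  have heq : diff (X : ι → MvPolynomial ι K) y (insert i G) = sign (MvPolynomial ι K) i (insert i G) *
      ∏ j ∈ insert i G, X j := by
    rw [diff_apply, Finset.sum_eq_single i]
    · rw [Finset.erase_insert hi, Finset.prod_insert hi]
      simp [y]
      ring
    · intro j hj hji
      have : (insert i G).erase j ≠ G := by
        intro h
        exact hi (h ▸ Finset.mem_erase.2 ⟨hji.symm, Finset.mem_insert_self i G⟩)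
      simp [y, this]
    · simp
  have := Ideal.mul_mem_left _ (sign (MvPolynomial ι K) i (insert i G)) hmem
  rw [heq, ← mul_assoc, Koszul.sign_mul_self, one_mul, prod_X_mem_pow_iff,
    Finset.card_insert_of_notMem hi] at this
  omega

end Quotients

/-- If few `d`-sets are missing from `U`, then some `(d - 1)`-set has all its supersets of
cardinality `d` in `U`. -/
lemma exists_forall_insert_mem {n d : ℕ} (hd : 0 < d) {U : Finset (Finset (Fin n))}
    (hU : ∀ F ∈ U, F.card = d)
    (h : ((n : ℚ) - d) / ((n : ℚ) - d + 1) * (n.choose d : ℚ) < U.card) :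
    ∃ G : Finset (Fin n), G.card + 1 = d ∧ (∃ i, i ∉ G) ∧ ∀ i ∉ G, insert i G ∈ U := by
  obtain ⟨e, rfl⟩ : ∃ e, d = e + 1 := ⟨d - 1, by omega⟩
  have hsub : U ⊆ Finset.powersetCard (e + 1) Finset.univ := fun F hF ↦ by
    simpa [Finset.mem_powersetCard] using hU F hF
  have hcard : U.card ≤ n.choose (e + 1) := by
    simpa using Finset.card_le_card hsub
  have hn : e + 1 ≤ n := by
    by_contra! hlt
    have h0 := Nat.choose_eq_zero_of_lt hlt
    rw [h0] at hcard h
    have : U.card = 0 := by omega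
    simp [this] at h
  by_contra! hcon
  set B := Finset.powersetCard (e + 1) Finset.univ \ U
  have hB : B.card + U.card = n.choose (e + 1) := by
    simpa using Finset.card_sdiff_add_card_eq_card hsub
  -- Without a suitable `G`, every `(d-1)`-set lies in a missing `d`-set, and each missing set
  -- covers only `d` of them.
  have hcover : Finset.powersetCard e (Finset.univ : Finset (Fin n)) ⊆
      B.biUnion fun F ↦ F.powersetCard e := by
    intro G hG
    have hGc : G.card = e := (Finset.mem_powersetCard.1 hG).2
    have hex : ∃ i, i ∉ G := by
      by_contra! hall
      have := Finset.eq_univ_iff_forall.2 hall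
      rw [this] at hGc
      simp at hGc
      omega
    obtain ⟨i, hi, hiU⟩ := hcon G (by omega) hex
    rw [Finset.mem_biUnion]
    refine ⟨insert i G, ?_, Finset.mem_powersetCard.2 ⟨Finset.subset_insert _ _, hGc⟩⟩
    simp [B, hiU, Finset.mem_powersetCard, Finset.card_insert_of_notMem hi, hGc]
  have hle : n.choose e ≤ B.card * (e + 1) := by
    have h₁ := (Finset.card_le_card hcover).trans
      (Finset.card_biUnion_le_card_mul B _ (e + 1) fun F hF ↦ by
        have : F.card = e + 1 := by
          simp only [B, Finset.mem_sdiff, Finset.mem_powersetCard] at hF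
          exact hF.1.2
        simp [this])
    simpa using h₁
  have hchoose := Nat.choose_succ_right_eq n e
  -- With `k = n - d`, the cover gives `(k + 1) * B.card ≥ n.choose d`, contradicting the lower
  -- bound on `U.card`.
  obtain ⟨k, rfl⟩ := Nat.exists_eq_add_of_le hn
  rw [show e + 1 + k - e = k + 1 by omega] at hchoose
  have hk : ((e + 1 + k : ℕ) : ℚ) - ((e + 1 : ℕ) : ℚ) = k := by push_cast; ring
  rw [hk, div_mul_eq_mul_div, div_lt_iff₀ (by positivity)] at h
  have h' : k * (e + 1 + k).choose (e + 1) < U.card * (k + 1) := by exact_mod_cast h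
  have h₂ : (e + 1 + k).choose (e + 1) ≤ B.card * (k + 1) := by
    have := Nat.mul_le_mul_right (k + 1) hle
    rw [← hchoose] at this
    refine le_of_mul_le_mul_right (a := e + 1) ?_ (by omega)
    linarith
  nlinarith

end SquarefreeMonomialIdeal

/-! ### The depth computation -/

open SquarefreeMonomialIdeal Koszul MvPolynomial RingTheory.Sequence in
theorem corollary3 {K : Type*} [Field K] (n d : ℕ) (hd : 0 < d)
    (I : Ideal (MvPolynomial (Fin n) K))
    (hI : ∃ A : Set (MvPolynomial (Fin n) K),
      (∀ f ∈ A, IsSquarefreeMonomialOfDegree d f) ∧ Ideal.span A = I)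
    (hμ : (Submodule.spanFinrank I : ℚ) >
      (((n : ℚ) - (d : ℚ)) / ((n : ℚ) - (d : ℚ) + 1)) * (n.choose d : ℚ)) :
    polyDepth (K := K) (n := n) I = (d : ℕ∞) := by
  classical
  obtain ⟨A, hA, rfl⟩ := hI
  set V : Finset (Finset (Fin n)) := {F | ∏ i ∈ F, X i ∈ A}
  have hAV : A = (fun F ↦ ∏ i ∈ F, X i) '' (V : Set (Finset (Fin n))) := by
    ext f
    constructor
    · intro hf
      obtain ⟨F, -, rfl⟩ := hA f hf
      exact ⟨F, by simpa [V] using hf, rfl⟩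
    · rintro ⟨F, hF, rfl⟩
      simpa [V] using hF
  have hVd (F) (hF : F ∈ V) : F.card = d := by
    obtain ⟨G, hG, h⟩ := hA (∏ i ∈ F, X i) (by simpa [V] using hF)
    rwa [prod_X_injective h]
  have hpow : Ideal.span A ≤ idealOfVars (Fin n) K ^ d := by
    rw [hAV, Ideal.span_le]
    rintro _ ⟨F, hF, rfl⟩
    exact (prod_X_mem_pow_iff F d).2 (hVd F hF).ge
  have hcard : (Ideal.span A).spanFinrank ≤ V.card := by
    have hfin : A.Finite := hAV ▸ V.finite_toSet.image _
    refine (Submodule.spanFinrank_span_le_ncard_of_finite hfin).trans ?_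
    rw [hAV]
    exact (Set.ncard_image_le V.finite_toSet).trans (Set.ncard_coe_finset V).le
  obtain ⟨G, hG, ⟨i, hi⟩, hGV⟩ := exists_forall_insert_mem hd hVd
    (hμ.trans_le (by exact_mod_cast hcard))
  have hmemI (j) (hj : j ∉ G) : ∏ k ∈ insert j G, X k ∈ Ideal.span A :=
    Ideal.subset_span (by simpa [V] using hGV j hj)
  -- A degree-`d` generator cannot lie in `(x) I`. This excludes the infinite case of `idealGrade`
  -- and upgrades weakly regular to regular sequences.
  have hsmul : idealOfVars (Fin n) K • (⊤ : Submodule (MvPolynomial (Fin n) K) (Ideal.span A)) ≠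
      ⊤ := by
    intro h
    have hle : Ideal.span A ≤ idealOfVars (Fin n) K * Ideal.span A := by
      have := congrArg (Submodule.map (Ideal.span A).subtype) h
      rw [Submodule.map_smul'', Submodule.map_top, Submodule.range_subtype] at this
      exact this.ge
    have := (hle.trans (Ideal.mul_mono_right hpow)) (hmemI i hi)
    rw [← pow_succ', prod_X_mem_pow_iff, Finset.card_insert_of_notMem hi] at this
    omega
  have hvan : VanishesBelow (X : Fin n → MvPolynomial (Fin n) K) (Ideal.span A) d := by
    -- The upward closure of `V` adds only multiples of generators, so the ideal is unchanged.
    set U : Finset (Finset (Fin n)) := {F | ∃ G ∈ V, G ⊆ F}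
    have hspan : Ideal.span A = squarefreeIdeal K U := by
      rw [hAV]
      refine le_antisymm (Ideal.span_mono (Set.image_mono fun F hF ↦ ?_)) ?_
      · simpa [U] using ⟨F, hF, subset_rfl⟩
      · rw [squarefreeIdeal, Ideal.span_le]
        rintro _ ⟨F, hF, rfl⟩
        obtain ⟨H, hH, hHF⟩ : ∃ G ∈ V, G ⊆ F := by simpa [U] using hF
        exact Ideal.mem_of_dvd _ (Finset.prod_dvd_prod_of_subset _ _ _ hHF)
          (Ideal.subset_span ⟨H, hH, rfl⟩)
    rw [hspan]
    refine vanishesBelow_squarefreeIdeal U ?_ ?_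
    · intro F F' hF h
      simp only [U, Finset.coe_filter, Set.mem_ofPred_eq, Finset.mem_univ, true_and] at h ⊢
      obtain ⟨H, hH, hHF⟩ := h
      exact ⟨H, hH, hHF.trans hF⟩
    · intro F hF
      obtain ⟨H, hH, hHF⟩ : ∃ G ∈ V, G ⊆ F := by simpa [U] using hF
      exact (hVd H hH).ge.trans (Finset.card_le_card hHF)
  rw [polyDepth, idealGrade, if_neg hsmul]
  refine le_antisymm (iSup₂_le fun rs hrs ↦ ?_) ?_
  · have h := VanishesBelow.of_isWeaklyRegular (x := X) rs hrs.1 _ hrs.2.toIsWeaklyRegular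
    by_contra! hlt
    refine not_vanishesBelow hpow hG hmemI hi (h.mono ?_)
    exact_mod_cast hlt
  · obtain ⟨rs, hrs, hreg, hlen⟩ := hvan.exists_isWeaklyRegular
    rw [← hlen]
    refine le_iSup₂_of_le rs ⟨hrs, hreg, fun h ↦ hsmul ?_⟩ le_rfl
    exact top_le_iff.1 (h.le.trans (Submodule.smul_mono_left (Ideal.span_le.2 hrs)))
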